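/- Let $G=(V,E,\ell)$ be a compact metric graph: $(V,E)$ is a finite connected graph (loops and multiple edges allowed) with at least one edge, $\ell\colon E\to(0,\infty)$ is an edge length function, and $G$ is the topological space obtained from the intervals $[0,\ell(e)]$, $e\in E$, by glueing endpoints that correspond to the same vertex. The degree $\deg(v)$ of a vertex $v$ is the number of edges incident to $v$ (loops counted twice), and $\deg(x):=2$ for $x\in G\setminus V$. Let $H^1(G)$ be the space of continuous functions $f\colon G\to\mathbb R$ with $f|_e\in H^1((0,\ell(e)))$ for every edge $e$, and let $q(f,g)=\int_G f'g'\,dx$ and $q(f)=q(f,f)$. For a Borel probability measure $\mu$ on $G$, let $H^1(G,\mu)\subset H^1(G)$ be the subspace of those $f$ that are harmonic on $G\setminus\operatorname{supp}\mu$, i.e. $q(f,g)=0$ for all $g\in H^1(G)$ vanishing on $\operatorname{supp}\mu$. Regarding $H^1(G,\mu)$ as a subspace of $L^2(G,\mu)$, let $H_\mu$ be the self-adjoint operator in $L^2(G,\mu)$ associated with the form $q|_{H^1(G,\mu)}$: $f\in\operatorname{dom}(H_\mu)$ and $H_\mu f=g$ if and only if $f\in H^1(G,\mu)$ and $q(f,\varphi)=\int_G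 g\varphi\,d\mu$ for all $\varphi\in H^1(G,\mu)$. Its spectrum is discrete; let $0=\lambda_0(H_\mu)<\lambda_1(H_\mu)\le\lambda_2(H_\mu)\le\cdots$ be its eigenvalues counted with multiplicity, with $\lambda_k(H_\mu):=\infty$ if $k\ge\dim L^2(G,\mu)$. Put $$\lambda_1^{\min}(G):=\min_\mu\lambda_1(H_\mu),$$ the minimum being over all Borel probability measures $\mu$ on $G$. Theorem. Let $\mu$ be a Borel probability measure on $G$ with $\lambda_1(H_\mu)=\lambda_1^{\min}(G)$, and let $x,y\in G$ be such that $\mu=\tfrac12(\delta_x+\delta_y)$. Then $\deg(x)\in\{1,2\}$ and $\deg(y)\in\{1,2\}$. -/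

import Mathlib

open MeasureTheory Set

/-- A finite connected graph (multiple edges and loops are allowed) with vertex set `V` and edge
set `E`, together with an orientation of the edges and positive edge lengths. -/
structure MetricGraph (V E : Type*) where
  /-- the initial vertex of an edge -/
  src : E → V
  /-- the terminal vertex of an edge -/
  tgt : E → V
  /-- the edge length function -/
  len : E → ℝ
  len_pos : ∀ e, 0 < len e
  nonempty : Nonempty V
  connected : ∀ u v : V, Relation.ReflTransGen
    (fun a b => ∃ e, (src e = a ∧ tgt e = b) ∨ (src e = b ∧ tgt e = a)) u v

namespace MetricGraph

noncomputable section

variable {V E : Type*} (G : MetricGraph V E)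

/-- The number of edges incident to a vertex, loops being counted twice. -/
def vertexDegree (v : V) : ℕ := {e : E | G.src e = v}.ncard + {e : E | G.tgt e = v}.ncard

/-- The disjoint union of the vertices and of the intervals `[0, len e]`, before glueing. -/
def PreSpace : Type _ := V ⊕ (Σ e : E, Icc (0 : ℝ) (G.len e))

/-- Disjoint union topology: the vertices are isolated points, the intervals carry their usual
topology. -/
instance : TopologicalSpace G.PreSpace :=
  letI : TopologicalSpace V := ⊥
  inferInstanceAs (TopologicalSpace (V ⊕ (Σ e : E, Icc (0 : ℝ) (G.len e))))

/-- The endpoints of each interval are glued to the initial and terminal vertex of the edge. -/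
inductive Glue : G.PreSpace → G.PreSpace → Prop
  | left (e : E) : Glue (Sum.inr ⟨e, ⟨0, le_refl _, (G.len_pos e).le⟩⟩) (Sum.inl (G.src e))
  | right (e : E) : Glue (Sum.inr ⟨e, ⟨G.len e, (G.len_pos e).le, le_refl _⟩⟩) (Sum.inl (G.tgt e))

/-- The metric graph as a space: the topological quotient by the equivalence relation generated
by the glueing. -/
def Space : Type _ := Quot G.Glue

instance : TopologicalSpace G.Space := inferInstanceAs (TopologicalSpace (Quot G.Glue))

instance : MeasurableSpace G.Space := borel G.Space

instance : BorelSpace G.Space := ⟨rfl⟩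

/-- The point of the metric graph given by a vertex. -/
def vertex (v : V) : G.Space := Quot.mk _ (Sum.inl v)

/-- The parametrization of the edge `e` by `[0, len e]`; parameters outside this interval are
sent to the nearest endpoint and play no role. -/
def edge (e : E) (t : ℝ) : G.Space :=
  Quot.mk _ (Sum.inr ⟨e, projIcc 0 (G.len e) (G.len_pos e).le t⟩)

open Classical in
theorem vertex_injective : Function.Injective G.vertex := by
  let F : G.Space → Option V := Quot.lift
    (fun p : G.PreSpace => match p with
      | Sum.inl v => some v
      | Sum.inr ⟨e, t⟩ =>
          if t.1 = 0 then some (G.src e) else if t.1 = G.len e then some (G.tgt e) else none)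
    (by
      rintro _ _ (e | e)
      · simp
      · simp [(G.len_pos e).ne'])
  intro v w h
  exact Option.some.inj (congrArg F h)

open Classical in
/-- The degree of a point: the degree of the vertex if the point is a vertex, and `2` otherwise. -/
def degree (x : G.Space) : ℕ :=
  if h : ∃ v, G.vertex v = x then G.vertexDegree h.choose else 2

theorem degree_vertex (v : V) : G.degree (G.vertex v) = G.vertexDegree v := by
  have h : ∃ w, G.vertex w = G.vertex v := ⟨v, rfl⟩
  rw [degree, dif_pos h, G.vertex_injective h.choose_spec]

/-- `g` is the distributional derivative of `f` on `(0, a)`, and it is square integrable. -/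
def HasWeakDeriv (a : ℝ) (f g : ℝ → ℝ) : Prop :=
  MemLp g 2 (volume.restrict (Ioo 0 a)) ∧
    ∀ φ : ℝ → ℝ, ContDiff ℝ (⊤ : ℕ∞) φ → HasCompactSupport φ → tsupport φ ⊆ Ioo 0 a →
      ∫ t in Ioo 0 a, f t * deriv φ t = -∫ t in Ioo 0 a, g t * φ t

/-- The Sobolev space `H¹((0, a))`. -/
def IsIntervalH1 (a : ℝ) (f : ℝ → ℝ) : Prop :=
  MemLp f 2 (volume.restrict (Ioo 0 a)) ∧ ∃ g, HasWeakDeriv a f g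

open Classical in
/-- The (almost everywhere unique) distributional derivative of `f` on `(0, a)`. -/
def weakDeriv (a : ℝ) (f : ℝ → ℝ) : ℝ → ℝ :=
  if h : ∃ g, HasWeakDeriv a f g then h.choose else 0

/-- The Sobolev space `H¹(G)`. -/
def H1 : Set (G.Space → ℝ) :=
  {f | Continuous f ∧ ∀ e, IsIntervalH1 (G.len e) (fun t => f (G.edge e t))}

/-- The energy form `q(f, g) = ∫_G f' g' dx`. -/
def energy [Fintype E] (f g : G.Space → ℝ) : ℝ :=
  ∑ e, ∫ t in Ioo 0 (G.len e),
    weakDeriv (G.len e) (fun s => f (G.edge e s)) t *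
      weakDeriv (G.len e) (fun s => g (G.edge e s)) t

/-- Harmonicity of `f ∈ H¹(G)` on `O`. -/
def IsHarmonicOn [Fintype E] (f : G.Space → ℝ) (O : Set G.Space) : Prop :=
  ∀ g ∈ G.H1, (∀ z, z ∉ O → g z = 0) → G.energy f g = 0

/-- The space `H¹(G, μ)` of all functions in `H¹(G)` that are harmonic off the support of `μ`. -/
def H1Measure [Fintype E] (μ : Measure G.Space) : Set (G.Space → ℝ) :=
  {f | f ∈ G.H1 ∧ G.IsHarmonicOn f μ.supportᶜ}

/-- The Laplacian `H_μ` in `L²(G, μ)`, through its graph: `u ∈ dom H_μ` and `H_μ u = v`. This means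
that `u` is the class of some `f ∈ H¹(G, μ)` and `q(f, φ) = ∫ v φ dμ` for all `φ ∈ H¹(G, μ)`. -/
def IsLaplacian [Fintype E] (μ : Measure G.Space) (u v : Lp ℝ 2 μ) : Prop :=
  ∃ f ∈ G.H1Measure μ, (u : G.Space → ℝ) =ᵐ[μ] f ∧
    ∀ φ ∈ G.H1Measure μ, G.energy f φ = ∫ z, v z * φ z ∂μ

/-- The eigenvalue `λ_k(H_μ)`, where the eigenvalues are enumerated increasingly from `k = 0` on,
with multiplicities: the least `s` such that there are `k + 1` linearly independent eigenfunctions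
with eigenvalues at most `s`, and `∞` if there is no such `s`. -/
def eigenvalue [Fintype E] (k : ℕ) (μ : Measure G.Space) : EReal :=
  sInf {Λ : EReal | ∃ s : ℝ, Λ = (s : EReal) ∧ ∃ u : Fin (k + 1) → Lp ℝ 2 μ,
    LinearIndependent ℝ u ∧ ∀ i, ∃ t : ℝ, t ≤ s ∧ G.IsLaplacian μ (u i) (t • u i)}

/-- The optimal eigenvalue `λ_k^min(G)`: the minimum of `λ_k(H_μ)` over all Borel probability
measures `μ` on `G`. -/
def minEigenvalue [Fintype E] (k : ℕ) : EReal :=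
  ⨅ μ : ProbabilityMeasure G.Space, G.eigenvalue k (μ : Measure G.Space)

end

end MetricGraph

/-! View $G$ as an electrical network. For points $x, y$ let $k$ be the potential of a unit flow
between them, the Riesz representative of $f \mapsto f(x) - f(y)$ for the energy form, and let $R =
k(x) - k(y)$ be the effective resistance. On the measure $\frac12(\delta_x+\delta_y)$ with $R > 0$
the first nonzero eigenvalue is $4/R$: `IsPotential.eigenvalue_le` gives the upper bound,
`IsPotential.four_le_mul_of_linearIndependent` the lower one. So an optimal pair has maximal
resistance among all pairs (`IsPotential.sub_le_of_eigenvalue_eq_minEigenvalue`).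

Suppose that $x$ is a vertex. The currents leaving $x$ along the incident half-edges add up to one.
If one of them is $i < 3/8$, moving $x$ a little along that half-edge increases the resistance:
Cauchy-Schwarz bounds the new resistance from below through the trial field $\nabla k +
t\nabla\psi$, where $\psi$ is a tent peaking at the new point (`IsPotential.sq_sub_add_le`,
`IsPotential.flow_bound`). By maximality every current is at least $3/8$, hence $\frac38\deg(x) \le
1$ and $\deg(x) \le 2$ (`vertexDegree_le_two`). Any threshold above $1/3$ would do. Connectedness
gives $\deg(x) \ge 1$. -/

namespace MetricGraph
-- Weak derivatives and the fundamental theorem of calculus on an interval.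
noncomputable section

/-- Weak derivatives are unique almost everywhere. -/
theorem HasWeakDeriv.ae_eq {a : ℝ} {f g₁ g₂ : ℝ → ℝ} (h₁ : HasWeakDeriv a f g₁)
    (h₂ : HasWeakDeriv a f g₂) : g₁ =ᵐ[volume.restrict (Ioo 0 a)] g₂ := by
  have i₁ : IntegrableOn g₁ (Ioo 0 a) := h₁.1.integrable (by norm_num)
  have i₂ : IntegrableOn g₂ (Ioo 0 a) := h₂.1.integrable (by norm_num)
  have key : ∀ᵐ t, t ∈ Ioo 0 a → (g₁ - g₂) t = 0 := by
    refine isOpen_Ioo.ae_eq_zero_of_integral_contDiff_smul_eq_zero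
      (IntegrableOn.locallyIntegrableOn (i₁.sub i₂)) fun φ hφ hc hs => ?_
    have e : ∫ t, φ t • (g₁ - g₂) t = ∫ t in Ioo 0 a, φ t • (g₁ - g₂) t := by
      refine (setIntegral_eq_integral_of_forall_compl_eq_zero fun t ht => ?_).symm
      rw [image_eq_zero_of_notMem_tsupport fun h => ht (hs h), zero_smul]
    obtain ⟨C, hC⟩ := hc.exists_bound_of_continuous hφ.continuous
    have m₁ : Integrable (fun t => g₁ t * φ t) (volume.restrict (Ioo 0 a)) :=
      i₁.mul_bdd hφ.continuous.aestronglyMeasurable (Filter.Eventually.of_forall hC)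
    have m₂ : Integrable (fun t => g₂ t * φ t) (volume.restrict (Ioo 0 a)) :=
      i₂.mul_bdd hφ.continuous.aestronglyMeasurable (Filter.Eventually.of_forall hC)
    have := h₁.2 φ hφ hc hs
    have := h₂.2 φ hφ hc hs
    rw [e, show (fun t => φ t • (g₁ - g₂) t) = fun t => g₁ t * φ t - g₂ t * φ t by
      ext t; simp; ring, integral_sub m₁ m₂]
    linarith
  rw [Filter.EventuallyEq, ae_restrict_iff' measurableSet_Ioo]
  filter_upwards [key] with t ht hm
  exact sub_eq_zero.1 (ht hm)

/-- A continuous function whose distributional derivative on `(0, a)` vanishes is constant on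
`[0, a]`. -/
theorem eqOn_const_of_integral_mul_deriv_eq_zero {a : ℝ} (ha : 0 < a) {w : ℝ → ℝ}
    (hw : Continuous w)
    (h : ∀ φ : ℝ → ℝ, ContDiff ℝ (⊤ : ℕ∞) φ → HasCompactSupport φ → tsupport φ ⊆ Ioo 0 a →
      ∫ t in Ioo 0 a, w t * deriv φ t = 0) {t : ℝ} (ht : t ∈ Icc 0 a) : w t = w 0 := by
  let β : ContDiffBump (a / 2) := ⟨a / 8, a / 4, by positivity, by linarith⟩
  let ρ : ℝ → ℝ := β.normed volume
  have hρ : ContDiff ℝ (⊤ : ℕ∞) ρ := β.contDiff_normed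
  have hρs : tsupport ρ ⊆ Ioo 0 a := by
    rw [show tsupport ρ = _ from β.tsupport_normed_eq, Real.closedBall_eq_Icc]
    intro t ht
    change t ∈ Icc (a / 2 - a / 4) (a / 2 + a / 4) at ht
    constructor <;> linarith [ht.1, ht.2]
  have hρc : HasCompactSupport ρ := β.hasCompactSupport_normed
  have hρ1 : ∫ t, ρ t = 1 := β.integral_normed
  have key : ∀ᵐ t, t ∈ Ioo 0 a → w t - ∫ t, w t * ρ t = 0 := by
    refine isOpen_Ioo.ae_eq_zero_of_integral_contDiff_smul_eq_zero
      ((hw.sub continuous_const).locallyIntegrable.locallyIntegrableOn _) fun ψ hψ hc hs => ?_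
    -- Since `ρ` has mass one, `χ` has mean zero, so its primitive `φ` is again a test function on
    -- `(0, a)`. Testing with `φ` then identifies `w` with the constant `∫ w ρ`.
    let χ : ℝ → ℝ := fun t => ψ t - (∫ t, ψ t) * ρ t
    have hχ : ContDiff ℝ (⊤ : ℕ∞) χ := hψ.sub (contDiff_const.mul hρ)
    have hψi : Integrable ψ := hψ.continuous.integrable_of_hasCompactSupport hc
    have hρi : Integrable ρ := hρ.continuous.integrable_of_hasCompactSupport hρc
    have hχ0 : ∫ t, χ t = 0 := by
      rw [integral_sub hψi (hρi.const_mul _), integral_const_mul, hρ1]; ring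
    have hK : IsCompact (tsupport ψ ∪ tsupport ρ ∪ {a / 2}) :=
      (hc.isCompact.union hρc.isCompact).union isCompact_singleton
    have hne : (tsupport ψ ∪ tsupport ρ ∪ {a / 2}).Nonempty := ⟨a / 2, Or.inr rfl⟩
    have hsub : tsupport ψ ∪ tsupport ρ ∪ {a / 2} ⊆ Ioo 0 a :=
      union_subset (union_subset hs hρs) (singleton_subset_iff.2 ⟨by linarith, by linarith⟩)
    obtain ⟨p, hp, hpl⟩ := hK.exists_isLeast hne
    obtain ⟨q, hq, hqu⟩ := hK.exists_isGreatest hne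
    have hχz : ∀ t, t ∉ Icc p q → χ t = 0 := by
      intro t ht
      have h1 : t ∉ tsupport ψ := fun h => ht ⟨hpl (.inl (.inl h)), hqu (.inl (.inl h))⟩
      have h2 : t ∉ tsupport ρ := fun h => ht ⟨hpl (.inl (.inr h)), hqu (.inl (.inr h))⟩
      simp [χ, image_eq_zero_of_notMem_tsupport h1, image_eq_zero_of_notMem_tsupport h2]
    let φ : ℝ → ℝ := fun t => ∫ s in (0 : ℝ)..t, χ s
    have hφd : ∀ t, HasDerivAt φ (χ t) t := fun t => hχ.continuous.integral_hasStrictDerivAt 0 t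
      |>.hasDerivAt
    have hd : deriv φ = χ := funext fun t => (hφd t).deriv
    have hφ : ContDiff ℝ (⊤ : ℕ∞) φ :=
      contDiff_infty_iff_deriv.2 ⟨fun t => (hφd t).differentiableAt, hd ▸ hχ⟩
    have hφz : ∀ t, t ∉ Icc p q → φ t = 0 := by
      intro t ht
      have hp0 := (hsub hp).1
      rcases lt_or_ge t p with h1 | h1
      · refine intervalIntegral.integral_zero_ae (Filter.Eventually.of_forall fun s hs => ?_)
        refine hχz s fun h2 => ?_
        rw [uIoc, mem_Ioc] at hs
        rcases max_cases 0 t with h | h <;> linarith [hs.2, h2.1]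
      · have h2 : q < t := by
          by_contra h2
          exact ht ⟨h1, not_lt.1 h2⟩
        have hpq := hpl hq
        change ∫ s in (0 : ℝ)..t, χ s = 0
        rw [intervalIntegral.integral_of_le (by linarith), ← hχ0]
        refine setIntegral_eq_integral_of_forall_compl_eq_zero fun s hs => hχz s fun h3 => hs ?_
        exact ⟨by linarith [h3.1], by linarith [h3.2]⟩
    have hφs : tsupport φ ⊆ Icc p q := by
      refine closure_minimal (fun t ht => ?_) isClosed_Icc
      by_contra h
      exact ht (hφz t h)
    have hφc : HasCompactSupport φ := isCompact_Icc.of_isClosed_subset (isClosed_tsupport _) hφs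
    have := h φ hφ hφc (hφs.trans (Icc_subset_Ioo (hsub hp).1 (hsub hq).2))
    rw [hd, setIntegral_eq_integral_of_forall_compl_eq_zero] at this
    · have j1 : Integrable (fun t => w t * ψ t) :=
        (hw.mul hψ.continuous).integrable_of_hasCompactSupport hc.mul_left
      have j2 : Integrable (fun t => w t * ρ t) :=
        (hw.mul hρ.continuous).integrable_of_hasCompactSupport hρc.mul_left
      rw [show (fun t => w t * χ t) = fun t => w t * ψ t - (∫ t, ψ t) * (w t * ρ t) by
        ext t; simp only [χ]; ring, integral_sub j1 (j2.const_mul _), integral_const_mul] at this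
      rw [show (fun t => ψ t • (w t - ∫ t, w t * ρ t))
        = fun t => w t * ψ t - (∫ t, w t * ρ t) * ψ t by ext t; simp only [smul_eq_mul]; ring,
        integral_sub j1 (hψi.const_mul _), integral_const_mul]
      linarith
    · intro t ht
      rw [hχz t fun h => ht ⟨(hsub hp).1.trans_le h.1, h.2.trans_lt (hsub hq).2⟩, mul_zero]
  have e1 : EqOn w (fun _ => ∫ t, w t * ρ t) (Ioo 0 a) := by
    refine Measure.eqOn_open_of_ae_eq (μ := volume) ?_ isOpen_Ioo hw.continuousOn continuousOn_const
    rw [Filter.EventuallyEq, ae_restrict_iff' measurableSet_Ioo]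
    filter_upwards [key] with t ht hm
    exact sub_eq_zero.1 (ht hm)
  have e2 := e1.closure hw continuous_const
  rw [closure_Ioo ha.ne] at e2
  rw [e2 ht, e2 (left_mem_Icc.2 ha.le)]

theorem integral_Ioo_eq_intervalIntegral {a : ℝ} (ha : 0 ≤ a) (g : ℝ → ℝ) :
    ∫ t in Ioo 0 a, g t = ∫ t in (0 : ℝ)..a, g t := by
  rw [intervalIntegral.integral_of_le ha, integral_Ioc_eq_integral_Ioo]

theorem intervalIntegrable_of_memLp {a : ℝ} (ha : 0 ≤ a) {g : ℝ → ℝ}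
    (hg : MemLp g 2 (volume.restrict (Ioo 0 a))) : IntervalIntegrable g volume 0 a := by
  rw [intervalIntegrable_iff_integrableOn_Ioo_of_le ha]
  exact hg.integrable (by norm_num)

/-- The primitive of a square integrable function on `[0, a]` is continuous. -/
theorem continuous_primitive_projIcc {a : ℝ} (ha : 0 ≤ a) {g : ℝ → ℝ}
    (hg : MemLp g 2 (volume.restrict (Ioo 0 a))) :
    Continuous fun t : Icc 0 a => ∫ s in (0 : ℝ)..t, g s := by
  have h := intervalIntegrable_of_memLp ha hg
  have := intervalIntegral.continuousOn_primitive_interval' h left_mem_uIcc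
  rw [uIcc_of_le ha] at this
  exact continuousOn_iff_continuous_domRestrict.1 this

/-- The fundamental theorem of calculus: a primitive has the expected weak derivative. -/
theorem hasWeakDeriv_primitive {a : ℝ} (ha : 0 < a) {f g : ℝ → ℝ} {c : ℝ}
    (hg : MemLp g 2 (volume.restrict (Ioo 0 a)))
    (hf : ∀ t ∈ Icc 0 a, f t = c + ∫ s in (0 : ℝ)..t, g s) : HasWeakDeriv a f g := by
  refine ⟨hg, fun φ hφ hc hs => ?_⟩
  have h := intervalIntegrable_of_memLp ha.le hg
  let F : ℝ → ℝ := fun t => ∫ s in (0 : ℝ)..t, g s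
  have hF : AbsolutelyContinuousOnInterval F 0 a :=
    h.absolutelyContinuousOnInterval_intervalIntegral left_mem_uIcc
  have hφa : AbsolutelyContinuousOnInterval φ 0 a :=
    (hφ.of_le (by exact_mod_cast le_top)).contDiffOn.absolutelyContinuousOnInterval
  have hF' : ∀ᵐ t, t ∈ uIoc 0 a → deriv F t * φ t = g t * φ t := by
    filter_upwards [h.ae_hasDerivAt_integral] with t ht hm
    rw [(ht (uIoc_subset_uIcc hm) 0 left_mem_uIcc).deriv]
  have z0 : φ 0 = 0 := image_eq_zero_of_notMem_tsupport fun h => (hs h).1.false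
  have za : φ a = 0 := image_eq_zero_of_notMem_tsupport fun h => (hs h).2.false
  have dφ : Continuous (deriv φ) := hφ.continuous_deriv (by exact_mod_cast le_top)
  have e := hF.integral_mul_deriv_eq_deriv_mul hφa
  rw [intervalIntegral.integral_congr_ae hF', z0, za, mul_zero, mul_zero, sub_zero, zero_sub] at e
  have e3 : ∫ t in (0 : ℝ)..a, deriv φ t = 0 := by
    rw [intervalIntegral.integral_deriv_eq_sub (fun t _ => hφ.differentiable (by simp) t)
      (dφ.intervalIntegrable _ _), z0, za, sub_zero]
  rw [integral_Ioo_eq_intervalIntegral ha.le, integral_Ioo_eq_intervalIntegral ha.le, ← e,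
    intervalIntegral.integral_congr (g := fun t => c * deriv φ t + F t * deriv φ t),
    intervalIntegral.integral_add, intervalIntegral.integral_const_mul, e3, mul_zero, zero_add]
  · exact (dφ.intervalIntegrable _ _).const_mul c
  · exact (dφ.intervalIntegrable _ _).continuousOn_mul hF.continuousOn
  · intro t ht
    rw [uIcc_of_le ha.le] at ht
    simp only [hf t ht]
    ring

/-- The fundamental theorem of calculus for continuous functions with a weak derivative. -/
theorem HasWeakDeriv.eq_add_integral {a : ℝ} (ha : 0 < a) {f g : ℝ → ℝ} (hf : Continuous f)
    (h : HasWeakDeriv a f g) {t : ℝ} (ht : t ∈ Icc 0 a) :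
    f t = f 0 + ∫ s in (0 : ℝ)..t, g s := by
  -- Clamping makes the primitive continuous on all of `ℝ`, so that the constancy lemma applies to
  -- `f - F`.
  let F : ℝ → ℝ := fun t => ∫ s in (0 : ℝ)..(projIcc 0 a ha.le t), g s
  have hFc : Continuous F := (continuous_primitive_projIcc ha.le h.1).comp continuous_projIcc
  have hFt : ∀ t ∈ Icc 0 a, F t = 0 + ∫ s in (0 : ℝ)..t, g s := fun t ht => by
    simp [F, projIcc_of_mem ha.le ht]
  have hF := hasWeakDeriv_primitive ha h.1 hFt
  have e := eqOn_const_of_integral_mul_deriv_eq_zero ha (hf.sub hFc) (fun φ hφ hc hs => by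
    have e1 := h.2 φ hφ hc hs
    have e2 := hF.2 φ hφ hc hs
    have dφ : Continuous (deriv φ) := hφ.continuous_deriv (by exact_mod_cast le_top)
    have i1 : ∀ u : ℝ → ℝ, Continuous u →
        Integrable (fun t => u t * deriv φ t) (volume.restrict (Ioo 0 a)) := fun u hu =>
      ((hu.mul dφ).integrable_of_hasCompactSupport hc.deriv.mul_left).integrableOn
    simp only [Pi.sub_apply, sub_mul]
    rw [integral_sub (i1 f hf) (i1 F hFc), e1, e2, sub_self]) ht
  have h0 := hFt 0 (left_mem_Icc.2 ha.le)
  have h1 := hFt t ht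
  simp only [Pi.sub_apply, intervalIntegral.integral_same] at e h0
  linarith
end

/-! ### Functions in $H^1(G)$ from their derivatives; the energy as an inner product of gradients.
-/

noncomputable section
variable {V E : Type*} (G : MetricGraph V E)

theorem edge_zero (e : E) : G.edge e 0 = G.vertex (G.src e) := by
  rw [edge, projIcc_left]
  exact Quot.sound (Glue.left e)

theorem edge_len (e : E) : G.edge e (G.len e) = G.vertex (G.tgt e) := by
  rw [edge, projIcc_right]
  exact Quot.sound (Glue.right e)

theorem continuous_edge (e : E) : Continuous (G.edge e) := by
  let _ : TopologicalSpace V := ⊥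
  have h : Continuous fun t : Icc (0 : ℝ) (G.len e) =>
      (Sum.inr ⟨e, t⟩ : V ⊕ (Σ e : E, Icc (0 : ℝ) (G.len e))) :=
    continuous_inr.comp continuous_sigmaMk
  exact continuous_quot_mk.comp (h.comp continuous_projIcc)

/-- Every point is a vertex or lies in the interior of an edge. -/
theorem eq_vertex_or_eq_edge (z : G.Space) :
    (∃ v, z = G.vertex v) ∨ ∃ e, ∃ t ∈ Ioo 0 (G.len e), z = G.edge e t := by
  induction z using Quot.ind with
  | mk p =>
    rcases p with v | ⟨e, t⟩
    · exact .inl ⟨v, rfl⟩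
    · have h : (Quot.mk _ (Sum.inr ⟨e, t⟩) : G.Space) = G.edge e t := by
        rw [edge, projIcc_val]
      rw [h]
      rcases t.2.1.eq_or_lt with h0 | h0
      · exact .inl ⟨G.src e, by rw [← h0, edge_zero]⟩
      · rcases t.2.2.eq_or_lt with h1 | h1
        · exact .inl ⟨G.tgt e, by rw [h1, edge_len]⟩
        · exact .inr ⟨e, t, ⟨h0, h1⟩, rfl⟩

variable {G}

/-- The function on a metric graph with vertex values `c` and derivatives `g` along the edges. -/
def primitive (c : V → ℝ) (g : E → ℝ → ℝ)
    (hc : ∀ e, c (G.src e) + ∫ s in (0 : ℝ)..G.len e, g e s = c (G.tgt e)) : G.Space → ℝ :=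
  Quot.lift (Sum.elim c fun p => c (G.src p.1) + ∫ s in (0 : ℝ)..p.2.1, g p.1 s) (by
    rintro _ _ (e | e)
    · simp
    · simp [hc])

section primitive

variable {c : V → ℝ} {g : E → ℝ → ℝ}
  (hc : ∀ e, c (G.src e) + ∫ s in (0 : ℝ)..G.len e, g e s = c (G.tgt e))

@[simp]
theorem primitive_vertex (v : V) : primitive c g hc (G.vertex v) = c v := rfl

theorem primitive_edge {e : E} {t : ℝ} (ht : t ∈ Icc 0 (G.len e)) :
    primitive c g hc (G.edge e t) = c (G.src e) + ∫ s in (0 : ℝ)..t, g e s := by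
  rw [edge, projIcc_of_mem _ ht]
  rfl

theorem hasWeakDeriv_primitive_edge
    (hg : ∀ e, MemLp (g e) 2 (volume.restrict (Ioo 0 (G.len e)))) (e : E) :
    HasWeakDeriv (G.len e) (fun t => primitive c g hc (G.edge e t)) (g e) :=
  hasWeakDeriv_primitive (G.len_pos e) (hg e) fun _ ht => primitive_edge hc ht

theorem isIntervalH1_of_continuous {a : ℝ} {f : ℝ → ℝ} (hf : Continuous f)
    (h : ∃ g, HasWeakDeriv a f g) : IsIntervalH1 a f := by
  refine ⟨?_, h⟩
  have hb : Bornology.IsBounded (f '' Icc 0 a) := (isCompact_Icc.image hf).isBounded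
  obtain ⟨C, hC⟩ := hb.exists_norm_le
  refine MemLp.of_bound hf.aestronglyMeasurable C ?_
  filter_upwards [ae_restrict_mem measurableSet_Ioo] with t ht
  exact hC _ ⟨t, Ioo_subset_Icc_self ht, rfl⟩

theorem primitive_mem_H1 (hg : ∀ e, MemLp (g e) 2 (volume.restrict (Ioo 0 (G.len e)))) :
    primitive c g hc ∈ G.H1 := by
  have hcont : Continuous (primitive c g hc) := by
    refine continuous_quot_lift _ ?_
    let _ : TopologicalSpace V := ⊥
    have : DiscreteTopology V := ⟨rfl⟩
    change Continuous (Sum.elim c fun p : (Σ e : E, Icc (0 : ℝ) (G.len e)) =>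
      c (G.src p.1) + ∫ s in (0 : ℝ)..p.2.1, g p.1 s)
    refine continuous_of_discreteTopology.sumElim (continuous_sigma fun e => ?_)
    exact Continuous.add (f := fun _ => c (G.src e)) continuous_const
      (continuous_primitive_projIcc (G.len_pos e).le (hg e))
  exact ⟨hcont, fun e => isIntervalH1_of_continuous (hcont.comp (G.continuous_edge e))
    ⟨_, hasWeakDeriv_primitive_edge hc hg e⟩⟩

end primitive

theorem hasWeakDeriv_weakDeriv {a : ℝ} {f : ℝ → ℝ} (hf : IsIntervalH1 a f) :
    HasWeakDeriv a f (weakDeriv a f) := by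
  rw [weakDeriv, dif_pos hf.2]
  exact hf.2.choose_spec

variable (G) in
/-- The Hilbert space of square integrable vector fields. -/
abbrev Field [Fintype E] : Type _ :=
  PiLp 2 fun e : E => Lp ℝ 2 (volume.restrict (Ioo 0 (G.len e)))

section energy

variable [Fintype E]

/-- The vector field given by square integrable functions on the edges. -/
def field (g : E → ℝ → ℝ) (hg : ∀ e, MemLp (g e) 2 (volume.restrict (Ioo 0 (G.len e)))) :
    G.Field :=
  WithLp.toLp 2 fun e => (hg e).toLp

theorem inner_field {g h : E → ℝ → ℝ}
    (hg : ∀ e, MemLp (g e) 2 (volume.restrict (Ioo 0 (G.len e))))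
    (hh : ∀ e, MemLp (h e) 2 (volume.restrict (Ioo 0 (G.len e)))) :
    inner ℝ (field g hg) (field h hh) = ∑ e, ∫ t in Ioo 0 (G.len e), g e t * h e t := by
  rw [PiLp.inner_apply]
  refine Finset.sum_congr rfl fun e _ => ?_
  rw [L2.inner_def]
  refine integral_congr_ae ?_
  filter_upwards [(hg e).coeFn_toLp, (hh e).coeFn_toLp] with t h1 h2
  simp only [field, h1, h2]
  exact mul_comm _ _

/-- The gradient of a function in `H¹(G)`. -/
def grad (f : G.Space → ℝ) (hf : f ∈ G.H1) : G.Field :=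
  field (fun e => weakDeriv (G.len e) fun s => f (G.edge e s))
    fun e => (hasWeakDeriv_weakDeriv (hf.2 e)).1

theorem energy_eq_inner {f g : G.Space → ℝ} (hf : f ∈ G.H1) (hg : g ∈ G.H1) :
    G.energy f g = inner ℝ (grad f hf) (grad g hg) :=
  (inner_field _ _).symm

theorem grad_eq_field {f : G.Space → ℝ} (hf : f ∈ G.H1) {g : E → ℝ → ℝ}
    (h : ∀ e, HasWeakDeriv (G.len e) (fun t => f (G.edge e t)) (g e)) :
    grad f hf = field g fun e => (h e).1 := by
  refine PiLp.ext fun e => ?_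
  exact (MemLp.toLp_eq_toLp_iff (hasWeakDeriv_weakDeriv (hf.2 e)).1 (h e).1).2 ((hasWeakDeriv_weakDeriv (hf.2 e)).ae_eq (h e))

theorem grad_primitive {c : V → ℝ} {g : E → ℝ → ℝ}
    (hc : ∀ e, c (G.src e) + ∫ s in (0 : ℝ)..G.len e, g e s = c (G.tgt e))
    (hg : ∀ e, MemLp (g e) 2 (volume.restrict (Ioo 0 (G.len e)))) :
    grad (primitive c g hc) (primitive_mem_H1 hc hg) = field g hg :=
  grad_eq_field _ (hasWeakDeriv_primitive_edge hc hg)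

end energy

theorem eq_add_integral_weakDeriv {f : G.Space → ℝ} (hf : f ∈ G.H1) {e : E} {t : ℝ}
    (ht : t ∈ Icc 0 (G.len e)) :
    f (G.edge e t) = f (G.vertex (G.src e)) +
      ∫ s in (0 : ℝ)..t, weakDeriv (G.len e) (fun s => f (G.edge e s)) s := by
  rw [← edge_zero]
  exact (hasWeakDeriv_weakDeriv (hf.2 e)).eq_add_integral (G.len_pos e)
    (hf.1.comp (G.continuous_edge e)) ht

/-- The fundamental theorem of calculus on a subsegment. It turns the energy of any `f` against a
piecewise affine function into difference quotients of values of `f`. -/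
theorem integral_weakDeriv_mul_indicator {f : G.Space → ℝ} (hf : f ∈ G.H1) {e : E} {a b : ℝ}
    (ha : 0 ≤ a) (hab : a ≤ b) (hb : b ≤ G.len e) :
    ∫ t in Ioo 0 (G.len e), weakDeriv (G.len e) (fun s => f (G.edge e s)) t *
      (Ioc a b).indicator 1 t = f (G.edge e b) - f (G.edge e a) := by
  have hi := intervalIntegrable_of_memLp (G.len_pos e).le (hasWeakDeriv_weakDeriv (hf.2 e)).1
  rw [eq_add_integral_weakDeriv hf ⟨ha.trans hab, hb⟩,
    eq_add_integral_weakDeriv hf ⟨ha, hab.trans hb⟩, add_sub_add_left_eq_sub,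
    intervalIntegral.integral_interval_sub_left, intervalIntegral.integral_of_le hab]
  · rw [show (fun t => weakDeriv (G.len e) (fun s => f (G.edge e s)) t *
      (Ioc a b).indicator 1 t) = (Ioc a b).indicator
        (weakDeriv (G.len e) (fun s => f (G.edge e s))) by
      ext t; by_cases h : t ∈ Ioc a b <;> simp [h], ← integral_Ioc_eq_integral_Ioo,
      setIntegral_indicator measurableSet_Ioc,
      inter_eq_right.2 (Ioc_subset_Ioc ha hb)]
  · exact hi.mono_set (by rw [uIcc_of_le (ha.trans hab), uIcc_of_le (G.len_pos e).le]
                          exact Icc_subset_Icc_right hb)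
  · exact hi.mono_set (by rw [uIcc_of_le ha, uIcc_of_le (G.len_pos e).le]
                          exact Icc_subset_Icc_right (hab.trans hb))

theorem memLp_indicator (m a b : ℝ) :
    MemLp ((Ioc a b).indicator (1 : ℝ → ℝ)) 2 (volume.restrict (Ioo 0 m)) :=
  (memLp_const (1 : ℝ)).indicator measurableSet_Ioc

theorem integral_indicator_Ioc {a b t : ℝ} (ha : 0 ≤ a) (ht : 0 ≤ t) :
    ∫ s in (0 : ℝ)..t, (Ioc a b).indicator (1 : ℝ → ℝ) s = max a (min t b) - a := by
  rw [intervalIntegral.integral_of_le ht, setIntegral_indicator measurableSet_Ioc, Ioc_inter_Ioc]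
  simp [max_eq_right ha, Measure.real, ENNReal.toReal_ofReal']
  rcases le_total (min t b) a with h | h <;> simp [h]

end

/-! ### Potentials and effective resistance. -/

noncomputable section
variable {V E : Type*} {G : MetricGraph V E}

section single

variable [DecidableEq E]

theorem memLp_single {e : E} {g : ℝ → ℝ} (hg : MemLp g 2 (volume.restrict (Ioo 0 (G.len e))))
    (e' : E) : MemLp ((Pi.single e g : E → ℝ → ℝ) e') 2 (volume.restrict (Ioo 0 (G.len e'))) := by
  rcases eq_or_ne e' e with rfl | h
  · simpa using hg
  · simp [h]

variable [Fintype E]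

theorem inner_grad_single {f : G.Space → ℝ} (hf : f ∈ G.H1) {e : E} {g : ℝ → ℝ}
    (hg : MemLp g 2 (volume.restrict (Ioo 0 (G.len e)))) :
    inner ℝ (grad f hf) (field (Pi.single e g) (memLp_single hg)) =
      ∫ t in Ioo 0 (G.len e), weakDeriv (G.len e) (fun s => f (G.edge e s)) t * g t := by
  rw [grad, inner_field, Finset.sum_eq_single e]
  · simp
  · intro e' _ h
    simp [h]
  · simp

end single

variable [Fintype E]

/-- Differences of values are represented by vector fields. -/
theorem exists_inner_grad_eq_sub (x y : G.Space) :
    ∃ P : G.Field, ∀ f hf, inner ℝ P (grad f hf) = f x - f y := by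
  classical
  have symm : ∀ {x y : G.Space}, (∃ P : G.Field, ∀ f hf, inner ℝ P (grad f hf) = f x - f y) →
      ∃ P : G.Field, ∀ f hf, inner ℝ P (grad f hf) = f y - f x := by
    rintro x y ⟨P, hP⟩
    exact ⟨-P, fun f hf => by rw [inner_neg_left, hP, neg_sub]⟩
  have trans : ∀ {x y z : G.Space}, (∃ P : G.Field, ∀ f hf, inner ℝ P (grad f hf) = f x - f y) →
      (∃ P : G.Field, ∀ f hf, inner ℝ P (grad f hf) = f y - f z) →
      ∃ P : G.Field, ∀ f hf, inner ℝ P (grad f hf) = f x - f z := by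
    rintro x y z ⟨P, hP⟩ ⟨Q, hQ⟩
    exact ⟨P + Q, fun f hf => by rw [inner_add_left, hP, hQ, sub_add_sub_cancel]⟩
  -- The unit field along a path represents the difference of the end values; on a piece of one edge
  -- it is an indicator function.
  have edge : ∀ (e : E), ∀ t ∈ Icc 0 (G.len e), ∃ P : G.Field, ∀ f hf,
      inner ℝ P (grad f hf) = f (G.edge e t) - f (G.vertex (G.src e)) := by
    intro e t ht
    refine ⟨field _ (memLp_single (memLp_indicator (G.len e) 0 t)), fun f hf => ?_⟩
    rw [real_inner_comm, inner_grad_single _ (memLp_indicator _ _ _), integral_weakDeriv_mul_indicator hf le_rfl ht.1 ht.2,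
      edge_zero]
  have step : ∀ e, ∃ P : G.Field, ∀ f hf,
      inner ℝ P (grad f hf) = f (G.vertex (G.tgt e)) - f (G.vertex (G.src e)) := by
    intro e
    rw [← edge_len]
    exact edge e _ (right_mem_Icc.2 (G.len_pos e).le)
  have vert : ∀ u v : V, ∃ P : G.Field, ∀ f hf,
      inner ℝ P (grad f hf) = f (G.vertex u) - f (G.vertex v) := by
    intro u v
    induction G.connected u v with
    | refl => exact ⟨0, by simp⟩
    | tail _ h ih =>
      refine trans ih ?_
      obtain ⟨e, ⟨rfl, rfl⟩ | ⟨rfl, rfl⟩⟩ := h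
      · exact symm (step e)
      · exact step e
  have point : ∀ z : G.Space, ∃ v, ∃ P : G.Field, ∀ f hf,
      inner ℝ P (grad f hf) = f z - f (G.vertex v) := by
    intro z
    rcases G.eq_vertex_or_eq_edge z with ⟨v, rfl⟩ | ⟨e, t, ht, rfl⟩
    · exact ⟨v, 0, by simp⟩
    · exact ⟨_, edge e t (Ioo_subset_Icc_self ht)⟩
  obtain ⟨u, hu⟩ := point x
  obtain ⟨v, hv⟩ := point y
  exact trans hu (trans (vert u v) (symm hv))

variable (G) in
/-- The total of a vector field along each edge. -/
def flux : G.Field →L[ℝ] (E → ℝ) :=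
  ContinuousLinearMap.pi fun e =>
    (innerSL ℝ (indicatorConstLp 2 MeasurableSet.univ (measure_ne_top _ _) (1 : ℝ))).comp
      (PiLp.proj 2 (fun e : E => Lp ℝ 2 (volume.restrict (Ioo 0 (G.len e)))) e)

theorem flux_apply (P : G.Field) (e : E) :
    G.flux P e = ∫ t in (0 : ℝ)..G.len e, P e t := by
  rw [← integral_Ioo_eq_intervalIntegral (G.len_pos e).le]
  change inner ℝ (indicatorConstLp 2 MeasurableSet.univ _ (1 : ℝ)) (P e) = _
  rw [L2.inner_indicatorConstLp_one, setIntegral_univ]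

variable (G) in
/-- The differences of a vertex function along the edges. -/
def coboundary : (V → ℝ) →ₗ[ℝ] (E → ℝ)  where
  toFun c e := c (G.tgt e) - c (G.src e)
  map_add' c d := by
    ext e
    simp only [Pi.add_apply]
    ring
  map_smul' r c := by
    ext e
    simp only [Pi.smul_apply, smul_eq_mul, RingHom.id_apply]
    ring

variable (G) in
/-- The gradients of the functions in `H¹(G)` among all vector fields. -/
def gradients : Submodule ℝ G.Field :=
  (LinearMap.range G.coboundary).comap G.flux.toLinearMap

/-- Preimage under the continuous flux map of a subspace of the finite-dimensional space `E → ℝ`.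
Closedness provides the orthogonal projection used to construct potentials. -/
theorem isClosed_gradients : IsClosed (G.gradients : Set G.Field) :=
  (LinearMap.range G.coboundary).closed_of_finiteDimensional.preimage G.flux.continuous

theorem grad_mem_gradients {f : G.Space → ℝ} (hf : f ∈ G.H1) : grad f hf ∈ G.gradients := by
  refine ⟨fun v => f (G.vertex v), funext fun e => ?_⟩
  change f (G.vertex (G.tgt e)) - f (G.vertex (G.src e)) = G.flux (grad f hf) e
  rw [flux_apply, ← edge_len, eq_add_integral_weakDeriv hf (right_mem_Icc.2 (G.len_pos e).le),
    add_sub_cancel_left, ← integral_Ioo_eq_intervalIntegral (G.len_pos e).le,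
    ← integral_Ioo_eq_intervalIntegral (G.len_pos e).le]
  exact integral_congr_ae (hasWeakDeriv_weakDeriv (hf.2 e)).1.coeFn_toLp.symm

/-- A vertex function whose coboundary is the flux of `P` supplies the constants of integration. It
may be shifted by any real number, which allows the normalization at `x` and `y`. -/
theorem exists_grad_eq {P : G.Field} (hP : P ∈ G.gradients) (x y : G.Space) :
    ∃ f, ∃ hf : f ∈ G.H1, grad f hf = P ∧ f x + f y = 0 := by
  obtain ⟨c, hc⟩ := hP
  have hc : ∀ (r : ℝ) (e : E), c (G.src e) + r + ∫ s in (0 : ℝ)..G.len e, P e s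
      = c (G.tgt e) + r := by
    intro r e
    have : c (G.tgt e) - c (G.src e) = G.flux P e := congrFun hc e
    rw [flux_apply] at this
    linarith
  have hm : ∀ e, MemLp (P e) 2 (volume.restrict (Ioo 0 (G.len e))) := fun e => Lp.memLp _
  have add : ∀ (r : ℝ) (z : G.Space),
      primitive (fun v => c v + r) (fun e => P e) (hc r) z =
        primitive (fun v => c v + 0) (fun e => P e) (hc 0) z + r := by
    intro r z
    rcases G.eq_vertex_or_eq_edge z with ⟨v, rfl⟩ | ⟨e, t, ht, rfl⟩
    · simp
    · rw [primitive_edge _ (Ioo_subset_Icc_self ht), primitive_edge _ (Ioo_subset_Icc_self ht)]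
      ring
  let f := primitive (fun v => c v + 0) (fun e => P e) (hc 0)
  refine ⟨primitive (fun v => c v + (-(f x + f y) / 2)) (fun e => P e) (hc _),
    primitive_mem_H1 _ hm, ?_, ?_⟩
  · rw [grad_primitive _ hm]
    exact PiLp.ext fun e => Lp.toLp_coeFn _ (hm e)
  · have h1 := add (-(f x + f y) / 2) x
    have h2 := add (-(f x + f y) / 2) y
    change _ = f x + _ at h1
    change _ = f y + _ at h2
    rw [h1, h2]
    ring

variable (G) in
/-- `k` is the electrical potential of a unit flow from `y` to `x`, normalized to have mean zero
at these points. -/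
structure IsPotential (x y : G.Space) (k : G.Space → ℝ) : Prop where
  mem : k ∈ G.H1
  add_eq_zero : k x + k y = 0
  energy_eq : ∀ f ∈ G.H1, G.energy k f = f x - f y

/-- The projection to the gradients of a field representing $f(x) - f(y)$ still represents it, and
is itself a gradient. -/
theorem exists_isPotential (x y : G.Space) : ∃ k, G.IsPotential x y k := by
  obtain ⟨P, hP⟩ := exists_inner_grad_eq_sub x y
  have := isClosed_gradients (G := G).completeSpace_coe
  obtain ⟨k, hk, hkP, h0⟩ := exists_grad_eq (G.gradients.starProjection_apply_mem P) x y
  refine ⟨k, hk, h0, fun f hf => ?_⟩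
  rw [energy_eq_inner hk hf, ← hP f hf, hkP]
  have := G.gradients.starProjection_inner_eq_zero P _ (grad_mem_gradients hf)
  rw [inner_sub_left] at this
  linarith

namespace IsPotential

variable {x y : G.Space} {k : G.Space → ℝ}

theorem norm_sq (hk : G.IsPotential x y k) : ‖grad k hk.mem‖ ^ 2 = k x - k y := by
  rw [← hk.energy_eq k hk.mem, energy_eq_inner hk.mem hk.mem, real_inner_self_eq_norm_sq]

theorem sub_nonneg (hk : G.IsPotential x y k) : 0 ≤ k x - k y := hk.norm_sq ▸ sq_nonneg _

theorem inner_eq (hk : G.IsPotential x y k) {f : G.Space → ℝ} (hf : f ∈ G.H1) :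
    inner ℝ (grad k hk.mem) (grad f hf) = f x - f y := by
  rw [← hk.energy_eq f hf, energy_eq_inner hk.mem hf]

/-- Cauchy-Schwarz. Allowing arbitrary fields permits linear combinations of gradients as trial
fields directly. -/
theorem inner_sq_le (hk : G.IsPotential x y k) (P : G.Field) : (inner ℝ (grad k hk.mem) P) ^ 2 ≤ (k x - k y) * ‖P‖ ^ 2 := by
  rw [← hk.norm_sq, ← mul_pow]
  exact sq_le_sq.2 ((abs_real_inner_le_norm _ _).trans (le_abs_self _))

theorem sq_sub_le (hk : G.IsPotential x y k) {f : G.Space → ℝ} (hf : f ∈ G.H1) :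
    (f x - f y) ^ 2 ≤ (k x - k y) * G.energy f f := by
  rw [← hk.inner_eq hf, energy_eq_inner hf hf, real_inner_self_eq_norm_sq]
  exact hk.inner_sq_le _

end IsPotential

end

/-! ### The first nonzero eigenvalue of the uniform measure on two points. -/

noncomputable section
variable {V E : Type*} {G : MetricGraph V E}

/-- The uniform probability measure on a pair of points. -/
def pairMeasure (x y : G.Space) : Measure G.Space :=
  (2⁻¹ : ENNReal) • Measure.dirac x + (2⁻¹ : ENNReal) • Measure.dirac y

instance (x y : G.Space) : IsProbabilityMeasure (pairMeasure x y) :=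
  ⟨by simp [pairMeasure, ENNReal.inv_two_add_inv_two]⟩

theorem ae_pairMeasure_iff {x y : G.Space} {p : G.Space → Prop} (hp : MeasurableSet {z | p z}) :
    (∀ᵐ z ∂pairMeasure x y, p z) ↔ p x ∧ p y := by
  rw [pairMeasure, ae_add_measure_iff, Measure.ae_ennreal_smul_measure_iff (by simp),
    Measure.ae_ennreal_smul_measure_iff (by simp), ae_dirac_iff hp, ae_dirac_iff hp]

theorem left_mem_support (x y : G.Space) : x ∈ (pairMeasure x y).support := by
  rw [Measure.mem_support_iff_forall]
  intro U hU
  have := mem_of_mem_nhds hU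
  refine lt_of_lt_of_le ?_ (Measure.le_add_right le_rfl U)
  simp [Measure.dirac_apply_of_mem this]

theorem right_mem_support (x y : G.Space) : y ∈ (pairMeasure x y).support := by
  rw [pairMeasure, add_comm]
  exact left_mem_support y x

theorem integral_pairMeasure {x y : G.Space} {f : G.Space → ℝ} (hf : Continuous f) :
    ∫ z, f z ∂pairMeasure x y = (f x + f y) / 2 := by
  have hs : StronglyMeasurable f := hf.measurable.stronglyMeasurable
  have hi : ∀ z : G.Space, Integrable f ((2⁻¹ : ENNReal) • Measure.dirac z) := fun z =>
    (integrable_dirac' hs (by simp)).smul_measure (by simp)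
  rw [pairMeasure, integral_add_measure (hi x) (hi y), integral_smul_measure,
    integral_smul_measure, integral_dirac' _ _ hs, integral_dirac' _ _ hs]
  simp
  ring

theorem memLp_pairMeasure {x y : G.Space} {f : G.Space → ℝ} (hf : Continuous f) :
    MemLp f 2 (pairMeasure x y) := by
  refine MemLp.of_bound hf.measurable.aestronglyMeasurable (max ‖f x‖ ‖f y‖) ?_
  rw [ae_pairMeasure_iff (isClosed_le hf.norm continuous_const).measurableSet]
  exact ⟨le_max_left _ _, le_max_right _ _⟩

theorem const_mem_H1 (c : ℝ) : (fun _ => c) ∈ G.H1 :=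
  ⟨continuous_const, fun e => isIntervalH1_of_continuous continuous_const
    ⟨0, hasWeakDeriv_primitive (c := c) (G.len_pos e) MemLp.zero (by simp)⟩⟩

theorem integral_smul_mul {x y : G.Space} {u : Lp ℝ 2 (pairMeasure x y)} {f φ : G.Space → ℝ}
    (hf : Continuous f) (hu : u =ᵐ[pairMeasure x y] f) (hφ : Continuous φ) (t : ℝ) :
    ∫ z, (t • u : Lp ℝ 2 (pairMeasure x y)) z * φ z ∂pairMeasure x y =
      t * (f x * φ x + f y * φ y) / 2 := by
  rw [integral_congr_ae (g := fun z => t * (f z * φ z)),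
    integral_pairMeasure (f := fun z => t * (f z * φ z)) (by fun_prop)]
  · ring
  · filter_upwards [Lp.coeFn_smul t u, hu] with z h1 h2
    rw [h1, Pi.smul_apply, h2, smul_eq_mul, mul_assoc]

variable [Fintype E]

theorem grad_const (c : ℝ) : grad (fun _ => c) (const_mem_H1 (G := G) c) = 0 := by
  rw [grad_eq_field (g := 0) _ fun e =>
    hasWeakDeriv_primitive (c := c) (G.len_pos e) MemLp.zero (by simp)]
  rfl

theorem energy_const_right {f : G.Space → ℝ} (hf : f ∈ G.H1) (c : ℝ) :
    G.energy f (fun _ => c) = 0 := by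
  rw [energy_eq_inner hf (const_mem_H1 c), grad_const, inner_zero_right]

theorem energy_const_left {f : G.Space → ℝ} (hf : f ∈ G.H1) (c : ℝ) :
    G.energy (fun _ => c) f = 0 := by
  rw [energy_eq_inner (const_mem_H1 c) hf, grad_const, inner_zero_left]

theorem const_mem_H1Measure (μ : Measure G.Space) (c : ℝ) : (fun _ => c) ∈ G.H1Measure μ :=
  ⟨const_mem_H1 c, fun _ hg _ => energy_const_left hg c⟩

namespace IsPotential

variable {x y : G.Space} {k : G.Space → ℝ}

/-- Harmonicity needs only that `x` and `y` belong to the support; the support need not be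
determined. -/
theorem mem_H1Measure (hk : G.IsPotential x y k) : k ∈ G.H1Measure (pairMeasure x y) := by
  refine ⟨hk.mem, fun g hg h => ?_⟩
  rw [hk.energy_eq g hg, h x (not_not.2 (left_mem_support x y)),
    h y (not_not.2 (right_mem_support x y)), sub_zero]

/-- Testing with the constant one gives $t(f(x)+f(y)) = 0$. The case $t = 0$ would make the energy
vanish and force $f(x) = f(y)$; otherwise $f(y) = -f(x)$, and testing with $f$ gives $q(f) = t
f(x)^2$. Now insert this into $(f(x)-f(y))^2 \le R\,q(f)$. -/
theorem four_le_mul (hk : G.IsPotential x y k) {u : Lp ℝ 2 (pairMeasure x y)} {t : ℝ}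
    {f : G.Space → ℝ} (hf : f ∈ G.H1Measure (pairMeasure x y)) (hu : u =ᵐ[pairMeasure x y] f)
    (h : ∀ φ ∈ G.H1Measure (pairMeasure x y), G.energy f φ =
      ∫ z, (t • u : Lp ℝ 2 (pairMeasure x y)) z * φ z ∂pairMeasure x y) (hne : f x ≠ f y) :
    4 ≤ t * (k x - k y) := by
  have h1 := h _ (const_mem_H1Measure _ 1)
  have h2 := h f hf
  rw [energy_const_right hf.1, integral_smul_mul hf.1.1 hu continuous_const] at h1
  rw [integral_smul_mul hf.1.1 hu hf.1.1] at h2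
  have h3 := hk.sq_sub_le hf.1
  have hpos : 0 < (f x - f y) ^ 2 := by
    have := sub_ne_zero.2 hne
    positivity
  rcases eq_or_ne t 0 with rfl | ht
  · rw [h2, zero_mul, zero_div, mul_zero] at h3
    linarith
  · have h4 : f y = -f x := by
      have : t * (f x + f y) = 0 := by linarith
      have := (mul_eq_zero.1 this).resolve_left ht
      linarith
    rw [h2, h4] at h3
    rw [h4] at hpos
    have h5 : 0 < f x ^ 2 := by nlinarith
    refine le_of_mul_le_mul_right ?_ h5
    linarith

theorem four_le_mul_of_linearIndependent (hk : G.IsPotential x y k)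
    {u : Fin 2 → Lp ℝ 2 (pairMeasure x y)} (hu : LinearIndependent ℝ u) {s : ℝ}
    (h : ∀ i, ∃ t : ℝ, t ≤ s ∧ G.IsLaplacian (pairMeasure x y) (u i) (t • u i)) :
    4 ≤ s * (k x - k y) := by
  choose t hts f hf hfu hft using h
  -- Otherwise both classes are constant almost everywhere, hence linearly dependent.
  have hne : ∃ i, f i x ≠ f i y := by
    by_contra! hc
    have hae : ∀ i, u i =ᵐ[pairMeasure x y] fun _ => f i x := by
      intro i
      refine (hfu i).trans ?_
      refine (ae_pairMeasure_iff
        (isClosed_eq (hf i).1.1 continuous_const).measurableSet).2 ⟨rfl, (hc i).symm⟩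
    have key : f 1 x • u 0 + -f 0 x • u 1 = 0 := by
      rw [Lp.eq_zero_iff_ae_eq_zero]
      filter_upwards [Lp.coeFn_add (f 1 x • u 0) (-f 0 x • u 1), Lp.coeFn_smul (f 1 x) (u 0),
        Lp.coeFn_smul (-f 0 x) (u 1), hae 0, hae 1] with z h1 h2 h3 h4 h5
      rw [h1, Pi.add_apply, h2, h3, Pi.smul_apply, Pi.smul_apply, h4, h5]
      simp only [smul_eq_mul, Pi.zero_apply]
      ring
    have hz : f 1 x = 0 := (LinearIndependent.pair_iff.1
      (show LinearIndependent ℝ ![u 0, u 1] by convert hu using 1; ext i; fin_cases i <;> rfl)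
      _ _ key).1
    refine hu.ne_zero 1 (Lp.eq_zero_iff_ae_eq_zero.2 ?_)
    filter_upwards [hae 1] with z h1
    rw [h1, hz, Pi.zero_apply]
  obtain ⟨i, hi⟩ := hne
  exact (hk.four_le_mul (hf i) (hfu i) (hft i) hi).trans
    (mul_le_mul_of_nonneg_right (hts i) hk.sub_nonneg)

/-- The constant one and `k` are independent eigenfunctions for $0$ and $4/R$: the normalization
gives $k(x) = -k(y) = R/2$, so $\int k\varphi\,d\mu = \frac R4(\varphi(x)-\varphi(y)) = \frac R4
q(k,\varphi)$. -/
theorem eigenvalue_le (hk : G.IsPotential x y k) (hpos : 0 < k x - k y) :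
    G.eigenvalue 1 (pairMeasure x y) ≤ ((4 / (k x - k y) : ℝ) : EReal) := by
  have hy : k y = -k x := by linarith [hk.add_eq_zero]
  have hx : 0 < k x := by linarith
  let one : Lp ℝ 2 (pairMeasure x y) := (memLp_pairMeasure (f := fun _ => 1) continuous_const).toLp
  let u : Lp ℝ 2 (pairMeasure x y) := (memLp_pairMeasure hk.mem.1).toLp
  have h1 : one =ᵐ[pairMeasure x y] fun _ => 1 := MemLp.coeFn_toLp _
  have hu : u =ᵐ[pairMeasure x y] k := MemLp.coeFn_toLp _
  refine sInf_le ⟨_, rfl, ![one, u], ?_, ?_⟩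
  · refine LinearIndependent.pair_iff.2 fun a b hab => ?_
    have hae : ∀ᵐ z ∂pairMeasure x y, a + b * k z = 0 := by
      rw [Lp.eq_zero_iff_ae_eq_zero] at hab
      filter_upwards [hab, Lp.coeFn_add (a • one) (b • u), Lp.coeFn_smul a one,
        Lp.coeFn_smul b u, h1, hu] with z h0 h2 h3 h4 h5 h6
      rw [h2, Pi.add_apply, h3, h4, Pi.smul_apply, Pi.smul_apply, h5, h6] at h0
      simpa using h0
    have hcont : Continuous fun z => a + b * k z := by
      have := hk.mem.1
      fun_prop
    rw [ae_pairMeasure_iff (isClosed_eq hcont continuous_const).measurableSet, hy] at hae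
    have hb : b * k x = 0 := by linarith [hae.1, hae.2]
    exact ⟨by linarith [hae.1], (mul_eq_zero.1 hb).resolve_right hx.ne'⟩
  · intro i
    fin_cases i
    · refine ⟨0, by positivity, _, const_mem_H1Measure _ 1, h1, fun φ hφ => ?_⟩
      change _ = ∫ z, (((0 : ℝ) • one : Lp ℝ 2 (pairMeasure x y)) : G.Space → ℝ) z * φ z ∂_
      rw [energy_const_left hφ.1, integral_smul_mul continuous_const h1 hφ.1.1]
      ring
    · refine ⟨_, le_rfl, k, hk.mem_H1Measure, hu, fun φ hφ => ?_⟩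
      change _ = ∫ z, ((_ • u : Lp ℝ 2 (pairMeasure x y)) : G.Space → ℝ) z * φ z ∂_
      rw [hk.energy_eq φ hφ.1, integral_smul_mul hk.mem.1 hu hφ.1.1, hy]
      field_simp
      ring

/-- If the uniform measure on `{x, y}` is optimal, then `x` and `y` have maximal effective
resistance. -/
theorem sub_le_of_eigenvalue_eq_minEigenvalue (hk : G.IsPotential x y k)
    (hmin : G.eigenvalue 1 (pairMeasure x y) = G.minEigenvalue 1) {x' y' : G.Space}
    {k' : G.Space → ℝ} (hk' : G.IsPotential x' y' k') : k' x' - k' y' ≤ k x - k y := by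
  by_contra! hlt
  have hpos : 0 < k' x' - k' y' := hk.sub_nonneg.trans_lt hlt
  have hle : G.eigenvalue 1 (pairMeasure x y) ≤ ((4 / (k' x' - k' y') : ℝ) : EReal) := by
    rw [hmin]
    exact (iInf_le _ (⟨pairMeasure x' y', inferInstance⟩ : ProbabilityMeasure G.Space)).trans
      (hk'.eigenvalue_le hpos)
  rcases hk.sub_nonneg.eq_or_lt with h0 | h0
  -- If the resistance is zero, any admissible `s` would give `4 ≤ 0`, although `hle` makes the
  -- eigenvalue finite.
  · obtain ⟨_, ⟨s, -, u, hu, h⟩, -⟩ := sInf_lt_iff.1 (hle.trans_lt (EReal.coe_lt_top _))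
    have := hk.four_le_mul_of_linearIndependent hu h
    rw [← h0] at this
    linarith
  · have h1 : ((4 / (k' x' - k' y') : ℝ) : EReal) < ((4 / (k x - k y) : ℝ) : EReal) :=
      EReal.coe_lt_coe_iff.2 (div_lt_div_of_pos_left (by norm_num) h0 hlt)
    obtain ⟨_, ⟨s, rfl, u, hu, h⟩, hs⟩ := sInf_lt_iff.1 (hle.trans_lt h1)
    have := hk.four_le_mul_of_linearIndependent hu h
    rw [EReal.coe_lt_coe_iff, lt_div_iff₀ h0] at hs
    linarith

end IsPotential

end

/-! ### Moving one point of an optimal pair; the degree bound. -/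

noncomputable section
variable {V E : Type*} {G : MetricGraph V E}

section tent

variable [Fintype E]

/-- The piecewise affine function with peak value one at the point `b` of an edge and support
`[a, c]` in this edge. -/
theorem exists_tent (e : E) {a b c : ℝ} (ha : 0 ≤ a) (hab : a < b) (hbc : b < c)
    (hc : c ≤ G.len e) :
    ∃ ψ ∈ G.H1, (∀ v, ψ (G.vertex v) = 0) ∧
      (∀ e', ∀ t ∈ Icc 0 (G.len e'), e' ≠ e ∨ t ≤ a ∨ c ≤ t → ψ (G.edge e' t) = 0) ∧
      ψ (G.edge e b) = 1 ∧ ∀ k ∈ G.H1, G.energy k ψ =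
        (k (G.edge e b) - k (G.edge e a)) / (b - a) -
          (k (G.edge e c) - k (G.edge e b)) / (c - b) := by
  classical
  have hb : 0 ≤ b := ha.trans hab.le
  have hab' : b - a ≠ 0 := (sub_pos.2 hab).ne'
  have hbc' : c - b ≠ 0 := (sub_pos.2 hbc).ne'
  let g : ℝ → ℝ := (b - a)⁻¹ • (Ioc a b).indicator 1 - (c - b)⁻¹ • (Ioc b c).indicator 1
  have hg : MemLp g 2 (volume.restrict (Ioo 0 (G.len e))) :=
    ((memLp_indicator _ a b).const_smul _).sub ((memLp_indicator _ b c).const_smul _)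
  have hint : ∀ t, 0 ≤ t → ∫ s in (0 : ℝ)..t, g s =
      (b - a)⁻¹ * (max a (min t b) - a) - (c - b)⁻¹ * (max b (min t c) - b) := by
    intro t ht
    have hi : ∀ p q : ℝ, IntervalIntegrable ((Ioc p q).indicator (1 : ℝ → ℝ)) volume 0 t :=
      fun p q => intervalIntegrable_of_memLp ht (memLp_indicator t p q)
    simp only [g, Pi.sub_apply, Pi.smul_apply, smul_eq_mul]
    rw [intervalIntegral.integral_sub ((hi a b).const_mul _) ((hi b c).const_mul _),
      intervalIntegral.integral_const_mul, intervalIntegral.integral_const_mul,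
      integral_indicator_Ioc ha ht, integral_indicator_Ioc hb ht]
  have hz : ∀ t, 0 ≤ t → t ≤ a ∨ c ≤ t → ∫ s in (0 : ℝ)..t, g s = 0 := by
    rintro t ht (h | h)
    · rw [hint t ht, min_eq_left (h.trans hab.le), max_eq_left h,
        min_eq_left (h.trans (hab.trans hbc).le), max_eq_left (h.trans hab.le)]
      ring
    · rw [hint t ht, min_eq_right (hbc.le.trans h), max_eq_right hab.le, min_eq_right h,
        max_eq_right hbc.le]
      field_simp
      ring
  have hcomp : ∀ e', (0 : V → ℝ) (G.src e') + ∫ s in (0 : ℝ)..G.len e',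
      (Pi.single e g : E → ℝ → ℝ) e' s = (0 : V → ℝ) (G.tgt e') := by
    intro e'
    rcases eq_or_ne e' e with rfl | h
    · simp [hz _ (G.len_pos e').le (.inr hc)]
    · simp [h]
  refine ⟨primitive 0 (Pi.single e g) hcomp, primitive_mem_H1 _ (memLp_single hg), ?_, ?_, ?_, ?_⟩
  · simp
  · intro e' t ht h
    rw [primitive_edge _ ht]
    rcases eq_or_ne e' e with rfl | he
    · simp [hz t ht.1 (h.resolve_left (not_not.2 rfl))]
    · simp [he]
  · rw [primitive_edge _ ⟨hb, hbc.le.trans hc⟩, Pi.single_eq_same, hint b hb, min_self,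
      max_eq_right hab.le, min_eq_left hbc.le, max_self]
    simp [hab']
  · intro k hk
    rw [energy_eq_inner hk (primitive_mem_H1 _ (memLp_single hg)),
      grad_primitive _ (memLp_single hg), inner_grad_single hk hg,
      ← integral_weakDeriv_mul_indicator hk ha hab.le (hbc.le.trans hc),
      ← integral_weakDeriv_mul_indicator hk hb hbc.le hc, div_eq_inv_mul, div_eq_inv_mul,
      ← integral_const_mul, ← integral_const_mul, ← integral_sub]
    · refine integral_congr_ae (Filter.Eventually.of_forall fun t => ?_)
      simp only [g, Pi.sub_apply, Pi.smul_apply, smul_eq_mul]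
      ring
    · exact ((hasWeakDeriv_weakDeriv (hk.2 e)).1.integrable_mul
        (memLp_indicator _ a b)).const_mul _
    · exact ((hasWeakDeriv_weakDeriv (hk.2 e)).1.integrable_mul
        (memLp_indicator _ b c)).const_mul _

open Classical in
/-- The piecewise affine function with value one at the vertex `v` and support in the ball of
radius `s` around `v`. -/
theorem exists_star (v : V) {s : ℝ} (hs : 0 < s) (hsl : ∀ e, s ≤ G.len e) :
    ∃ φ ∈ G.H1, φ (G.vertex v) = 1 ∧ (∀ w, w ≠ v → φ (G.vertex w) = 0) ∧
      (∀ e, ∀ t ∈ Icc s (G.len e - s), φ (G.edge e t) = 0) ∧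
      ∀ k ∈ G.H1, G.energy k φ = ∑ e,
        ((if G.src e = v then (k (G.vertex v) - k (G.edge e s)) / s else 0) +
          if G.tgt e = v then (k (G.vertex v) - k (G.edge e (G.len e - s))) / s else 0) := by
  have hs0 : s ≠ 0 := hs.ne'
  let p : E → ℝ := fun e => if G.src e = v then -s⁻¹ else 0
  let q : E → ℝ := fun e => if G.tgt e = v then s⁻¹ else 0
  -- Only `s ≤ G.len e` is assumed, so at a loop the two end segments may overlap. Their slopes then
  -- add, and the energy formula persists.
  let g : E → ℝ → ℝ := fun e =>
    p e • (Ioc 0 s).indicator 1 + q e • (Ioc (G.len e - s) (G.len e)).indicator 1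
  have hg : ∀ e, MemLp (g e) 2 (volume.restrict (Ioo 0 (G.len e))) := fun e =>
    ((memLp_indicator _ _ _).const_smul _).add ((memLp_indicator _ _ _).const_smul _)
  have hint : ∀ e t, 0 ≤ t → ∫ r in (0 : ℝ)..t, g e r =
      p e * (max 0 (min t s) - 0) +
        q e * (max (G.len e - s) (min t (G.len e)) - (G.len e - s)) := by
    intro e t ht
    have hi : ∀ a b : ℝ, IntervalIntegrable ((Ioc a b).indicator (1 : ℝ → ℝ)) volume 0 t :=
      fun a b => intervalIntegrable_of_memLp ht (memLp_indicator t a b)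
    simp only [g, Pi.add_apply, Pi.smul_apply, smul_eq_mul]
    rw [intervalIntegral.integral_add ((hi _ _).const_mul _) ((hi _ _).const_mul _),
      intervalIntegral.integral_const_mul, intervalIntegral.integral_const_mul,
      integral_indicator_Ioc le_rfl ht, integral_indicator_Ioc (sub_nonneg.2 (hsl e)) ht]
  let c : V → ℝ := fun w => if w = v then 1 else 0
  have hcomp : ∀ e, c (G.src e) + ∫ r in (0 : ℝ)..G.len e, g e r = c (G.tgt e) := by
    intro e
    rw [hint e _ (G.len_pos e).le, min_eq_right (hsl e), max_eq_right hs.le, min_self,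
      max_eq_right (by linarith)]
    simp only [c, p, q]
    split_ifs <;> field_simp <;> ring
  refine ⟨primitive c g hcomp, primitive_mem_H1 _ hg, ?_, ?_, ?_, ?_⟩
  · simp [c]
  · intro w hw
    simp [c, hw]
  · intro e t ht
    have ht0 : 0 ≤ t := hs.le.trans ht.1
    have htl : t ≤ G.len e := by linarith [ht.2]
    rw [primitive_edge _ ⟨ht0, htl⟩, hint e t ht0, min_eq_right ht.1, max_eq_right hs.le,
      min_eq_left htl, max_eq_left ht.2]
    simp only [c, p]
    split_ifs <;> field_simp <;> ring
  · intro k hk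
    rw [energy_eq_inner hk (primitive_mem_H1 _ hg), grad_primitive _ hg, grad, inner_field]
    refine Finset.sum_congr rfl fun e _ => ?_
    have h1 := integral_weakDeriv_mul_indicator hk le_rfl hs.le (hsl e)
    have h2 := integral_weakDeriv_mul_indicator hk (sub_nonneg.2 (hsl e))
      (sub_le_self _ hs.le) le_rfl
    rw [edge_zero] at h1
    rw [edge_len] at h2
    have h3 : ∫ t in Ioo 0 (G.len e), weakDeriv (G.len e) (fun s => k (G.edge e s)) t * g e t =
        p e * (k (G.edge e s) - k (G.vertex (G.src e))) +
          q e * (k (G.vertex (G.tgt e)) - k (G.edge e (G.len e - s))) := by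
      rw [← h1, ← h2, ← integral_const_mul, ← integral_const_mul, ← integral_add]
      · refine integral_congr_ae (Filter.Eventually.of_forall fun t => ?_)
        simp only [g, Pi.add_apply, Pi.smul_apply, smul_eq_mul]
        ring
      · exact ((hasWeakDeriv_weakDeriv (hk.2 e)).1.integrable_mul
          (memLp_indicator _ _ _)).const_mul _
      · exact ((hasWeakDeriv_weakDeriv (hk.2 e)).1.integrable_mul
          (memLp_indicator _ _ _)).const_mul _
    rw [h3]
    simp only [p, q]
    split_ifs with h4 h5 h5
    · rw [h4, h5]; ring
    · rw [h4]; ring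
    · rw [h5]; ring
    · ring

end tent

variable [Fintype E]

namespace IsPotential

variable {x y : G.Space} {k : G.Space → ℝ}

/-- A bound for the effective resistance after moving one of the two points. -/
theorem sq_sub_add_le (hk : G.IsPotential x y k) {x' : G.Space} {k' : G.Space → ℝ}
    (hk' : G.IsPotential x' y k') {ψ : G.Space → ℝ} (hψ : ψ ∈ G.H1) (hx : ψ x = 0) (hy : ψ y = 0)
    (hx' : ψ x' = 1) (t : ℝ) :
    (k x' - k y + t) ^ 2 ≤ (k' x' - k' y) * (k x - k y + t ^ 2 * G.energy ψ ψ) := by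
  -- The cross term is `ψ x - ψ y = 0`, so the squared norm of the trial field is $R + t^2 q(\psi)$.
  have h := hk'.inner_sq_le (grad k hk.mem + t • grad ψ hψ)
  rw [inner_add_right, inner_smul_right, hk'.inner_eq hk.mem, hk'.inner_eq hψ, hx', hy,
    sub_zero, mul_one, norm_add_sq_real, inner_smul_right, hk.inner_eq hψ, hx, hy, hk.norm_sq,
    norm_smul, mul_pow, Real.norm_eq_abs, sq_abs, ← real_inner_self_eq_norm_sq (grad ψ hψ),
    ← energy_eq_inner] at h
  simpa using h

/-- In a pair of maximal effective resistance the flow out of a point along any segment is not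
too small. -/
theorem flow_bound (hk : G.IsPotential x y k)
    (hmax : ∀ x' k', G.IsPotential x' y k' → k' x' - k' y ≤ k x - k y)
    {x' : G.Space} {ψ : G.Space → ℝ} (hψ : ψ ∈ G.H1) (hx : ψ x = 0) (hy : ψ y = 0)
    (hx' : ψ x' = 1) {s i : ℝ} (hs : 0 < s) (hi : k x' = k x - s / 5 * i)
    (hE : G.energy ψ ψ = 25 / (4 * s)) : 3 / 8 ≤ i := by
  obtain ⟨k', hk'⟩ := exists_isPotential x' y
  -- With $d = s/5$, a tent of base $s$ and peak at $d$ has energy $1/d + 1/(4d) = 25/(4s)$. For $t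
  -- = d$ and by maximality, $(R + \frac s5(1-i))^2 \le R(R + \frac s4)$, whose terms linear in $s$
  -- give $\frac25(1-i) \le \frac14$, that is $i \ge 3/8$.
  have h := hk.sq_sub_add_le hk' hψ hx hy hx' (s / 5)
  have hR := hk.sub_nonneg
  have e : (s / 5) ^ 2 * (25 / (4 * s)) = s / 4 := by
    field_simp
    norm_num
  rw [hE, e, hi] at h
  have h2 := h.trans (mul_le_mul_of_nonneg_right (hmax x' k' hk') (by linarith))
  by_contra! hlt
  have hsq : 0 < (s / 5 * (1 - i)) ^ 2 := by
    have : 0 < 1 - i := by linarith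
    positivity
  have h3 : 0 ≤ (k x - k y) * (s * (3 / 8 - i)) :=
    mul_nonneg hR (mul_nonneg hs.le (by linarith))
  nlinarith

end IsPotential

/-- For equal points the resistance is zero, whereas a tent separates the midpoint of an edge from
its initial vertex, so their resistance is positive. -/
theorem ne_of_maximal [Nonempty E] {x y : G.Space} {k : G.Space → ℝ}
    (hmax : ∀ x' y' k', G.IsPotential x' y' k' → k' x' - k' y' ≤ k x - k y) : x ≠ y := by
  rintro rfl
  obtain ⟨e⟩ := ‹Nonempty E›
  have hl := G.len_pos e
  obtain ⟨ψ, hψ, hv, -, hb, -⟩ := exists_tent (G := G) e le_rfl (half_pos hl) (half_lt_self hl) le_rfl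
  obtain ⟨k', hk'⟩ := exists_isPotential (G.edge e (G.len e / 2)) (G.vertex (G.src e))
  have h1 := hk'.sq_sub_le hψ
  have h2 := hmax _ _ _ hk'
  have h3 : 0 ≤ G.energy ψ ψ := by
    rw [energy_eq_inner hψ hψ]
    exact real_inner_self_nonneg
  rw [hv, hb] at h1
  nlinarith

/-- A radius around a vertex in which a given other point does not lie. -/
theorem exists_radius [Nonempty E] {v : V} {y : G.Space} (hne : G.vertex v ≠ y) :
    ∃ s > 0, (∀ e, s ≤ G.len e) ∧ ((∃ w, w ≠ v ∧ y = G.vertex w) ∨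
      ∃ e, ∃ t ∈ Icc s (G.len e - s), y = G.edge e t) := by
  obtain ⟨e₀, he₀⟩ := Finite.exists_min G.len
  rcases G.eq_vertex_or_eq_edge y with ⟨w, rfl⟩ | ⟨e, t, ht, rfl⟩
  · exact ⟨G.len e₀, G.len_pos e₀, he₀, .inl ⟨w, fun h => hne (h ▸ rfl), rfl⟩⟩
  · refine ⟨min (G.len e₀) (min t (G.len e - t)),
      lt_min (G.len_pos e₀) (lt_min ht.1 (sub_pos.2 ht.2)),
      fun e => (min_le_left _ _).trans (he₀ e), .inr ⟨e, t, ⟨?_, ?_⟩, rfl⟩⟩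
    · exact (min_le_right _ _).trans (min_le_left _ _)
    · have := (min_le_right (G.len e₀) (min t (G.len e - t))).trans (min_le_right _ _)
      linarith

theorem vertexDegree_pos [Nonempty E] (v : V) : 0 < G.vertexDegree v := by
  have key : ∃ e, G.src e = v ∨ G.tgt e = v := by
    obtain ⟨e⟩ := ‹Nonempty E›
    rcases (G.connected (G.src e) v).cases_tail with h | ⟨w, -, e', h | h⟩
    · exact ⟨e, .inl h.symm⟩
    · exact ⟨e', .inr h.2⟩
    · exact ⟨e', .inl h.1⟩
  obtain ⟨e, h | h⟩ := key
  · exact Nat.add_pos_left ((ncard_pos (toFinite _)).2 ⟨e, h⟩) _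
  · exact Nat.add_pos_right _ ((ncard_pos (toFinite _)).2 ⟨e, h⟩)

open Classical in
theorem vertexDegree_eq_sum (v : V) : (G.vertexDegree v : ℝ) =
    ∑ e, ((if G.src e = v then 1 else 0) + if G.tgt e = v then 1 else 0) := by
  rw [Finset.sum_add_distrib, Finset.sum_boole, Finset.sum_boole, vertexDegree,
    ncard_eq_toFinset_card', ncard_eq_toFinset_card', toFinset_ofPred, toFinset_ofPred]
  push_cast
  rfl

/-- Kirchhoff's law: testing `k` with the star function at `v` shows that the currents on the
half-edges at `v` sum to one, while each is at least $3/8$. -/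
theorem vertexDegree_le_two [Nonempty E] {v : V} {y : G.Space} {k : G.Space → ℝ}
    (hk : G.IsPotential (G.vertex v) y k) (hne : G.vertex v ≠ y)
    (hmax : ∀ x' k', G.IsPotential x' y k' → k' x' - k' y ≤ k (G.vertex v) - k y) :
    G.vertexDegree v ≤ 2 := by
  classical
  obtain ⟨s, hs, hsl, hy⟩ := exists_radius hne
  have hψy : ∀ {ψ : G.Space → ℝ}, (∀ w, w ≠ v → ψ (G.vertex w) = 0) →
      (∀ e, ∀ t ∈ Icc s (G.len e - s), ψ (G.edge e t) = 0) → ψ y = 0 := by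
    intro ψ hw he
    rcases hy with ⟨w, hwv, rfl⟩ | ⟨e, t, ht, rfl⟩
    · exact hw w hwv
    · exact he e t ht
  have hsrc : ∀ e, G.src e = v → 3 / 8 ≤ (k (G.vertex v) - k (G.edge e s)) / s := by
    intro e he
    obtain ⟨ψ, hψ, hv, hz, hb, hE⟩ := exists_tent (G := G) e le_rfl
      (show 0 < s / 5 by positivity) (show s / 5 < s by linarith) (hsl e)
    have e1 : s - s / 5 = 4 * s / 5 := by ring
    rw [e1, sub_zero] at hE
    have hy0 : ψ y = 0 := hψy (fun w _ => hv w) fun e' t ht =>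
      hz e' t ⟨hs.le.trans ht.1, by linarith [ht.2]⟩ (.inr (.inr ht.1))
    refine hk.flow_bound hmax hψ (hv v) hy0 hb hs ?_ ?_
    -- As `ψ` vanishes at `v` and `y`, its energy against `k` is zero. Hence `k` interpolates
    -- linearly at the parameters `0`, `s / 5`, `s`, and the slope over the whole segment gives the
    -- value at the peak.
    · have h := hE k hk.mem
      rw [hk.energy_eq ψ hψ, hv, hy0, edge_zero, he] at h
      field_simp at h ⊢
      linarith
    · rw [hE ψ hψ, hb, edge_zero, hv, hz e s ⟨hs.le, hsl e⟩ (.inr (.inr le_rfl))]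
      field_simp
      norm_num
  have htgt : ∀ e, G.tgt e = v →
      3 / 8 ≤ (k (G.vertex v) - k (G.edge e (G.len e - s))) / s := by
    intro e he
    have hl := hsl e
    obtain ⟨ψ, hψ, hv, hz, hb, hE⟩ := exists_tent (G := G) e (sub_nonneg.2 hl)
      (show G.len e - s < G.len e - s / 5 by linarith)
      (show G.len e - s / 5 < G.len e by linarith) le_rfl
    have hy0 : ψ y = 0 := hψy (fun w _ => hv w) fun e' t ht => by
      rcases eq_or_ne e' e with rfl | h
      · exact hz _ t ⟨hs.le.trans ht.1, by linarith [ht.2]⟩ (.inr (.inl ht.2))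
      · exact hz e' t ⟨hs.le.trans ht.1, by linarith [ht.2]⟩ (.inl h)
    have e1 : G.len e - s / 5 - (G.len e - s) = 4 * s / 5 := by ring
    have e2 : G.len e - (G.len e - s / 5) = s / 5 := by ring
    rw [e1, e2] at hE
    refine hk.flow_bound hmax hψ (hv v) hy0 hb hs ?_ ?_
    · have h := hE k hk.mem
      rw [hk.energy_eq ψ hψ, hv, hy0, edge_len, he] at h
      field_simp at h ⊢
      linarith
    · rw [hE ψ hψ, hb, edge_len, hv,
        hz e (G.len e - s) ⟨sub_nonneg.2 hl, sub_le_self _ hs.le⟩ (.inr (.inl le_rfl))]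
      field_simp
      norm_num
  obtain ⟨φ, hφ, hφv, hφw, hφe, hφE⟩ := exists_star (G := G) v hs hsl
  have h1 := hφE k hk.mem
  rw [hk.energy_eq φ hφ, hφv, hψy hφw hφe, sub_zero] at h1
  have h2 : 3 / 8 * (G.vertexDegree v : ℝ) ≤ 1 := by
    refine le_of_le_of_eq ?_ h1.symm
    rw [vertexDegree_eq_sum, Finset.mul_sum]
    refine Finset.sum_le_sum fun e _ => ?_
    rw [mul_add]
    refine add_le_add ?_ ?_
    · split_ifs with h
      · simpa using hsrc e h
      · simp
    · split_ifs with h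
      · simpa using htgt e h
      · simp
  have h3 : (G.vertexDegree v : ℝ) < 3 := by linarith
  exact Nat.le_of_lt_succ (by exact_mod_cast h3)

/-- The left point of an optimal pair has degree one or two. -/
theorem degree_left_of_eigenvalue_eq_minEigenvalue [Nonempty E] {x y : G.Space}
    (hmin : G.eigenvalue 1 (pairMeasure x y) = G.minEigenvalue 1) :
    G.degree x = 1 ∨ G.degree x = 2 := by
  obtain ⟨k, hk⟩ := exists_isPotential x y
  have hmax := fun x' y' k' => hk.sub_le_of_eigenvalue_eq_minEigenvalue hmin (x' := x') (y' := y')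
    (k' := k')
  by_cases h : ∃ v, G.vertex v = x
  · obtain ⟨v, rfl⟩ := h
    rw [degree_vertex]
    have h1 := vertexDegree_le_two hk (ne_of_maximal hmax) fun x' k' => hmax x' y k'
    have h2 := vertexDegree_pos (G := G) v
    omega
  · exact .inr (by rw [degree, dif_neg h])

end
end MetricGraph

theorem mainTheorem8 {V E : Type*} [Fintype V] [Fintype E] [Nonempty E] (G : MetricGraph V E)
    (μ : Measure G.Space) [IsProbabilityMeasure μ]
    (hmin : G.eigenvalue 1 μ = G.minEigenvalue 1)
    (x y : G.Space)
    (hxy : μ = (2⁻¹ : ENNReal) • Measure.dirac x + (2⁻¹ : ENNReal) • Measure.dirac y) :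
    (G.degree x = 1 ∨ G.degree x = 2) ∧ (G.degree y = 1 ∨ G.degree y = 2) := by
  obtain rfl : μ = MetricGraph.pairMeasure x y := hxy
  -- The measure is symmetric in the two points, so the statement for the left point also covers
  -- `y`.
  refine ⟨MetricGraph.degree_left_of_eigenvalue_eq_minEigenvalue hmin,
    MetricGraph.degree_left_of_eigenvalue_eq_minEigenvalue (y := x) ?_⟩
  rwa [MetricGraph.pairMeasure, add_comm]
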